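/- For an index $\mathbf{l}=(l_1,\dots,l_n)$ of positive integers with $l_1\ge 2$, let $$\zeta(l_1,\dots,l_n)=\sum_{m_1>\dots>m_n\ge 1}\frac{1}{m_1^{l_1}\cdots m_n^{l_n}},\qquad \zeta^t(l_1,\dots,l_n)=\sum_{\mathbf{p}=(l_1\square l_2\square\cdots\square l_n)} t^{\,n-\mathrm{dep}(\mathbf{p})}\,\zeta(\mathbf{p})\in\mathbb{R}[t],$$ where each $\square$ runs over the two choices "," and "+", $t$ is a formal variable, and $\mathrm{dep}(\mathbf{p})$ is the number of entries of $\mathbf{p}$. Write $\{1\}^j$ for $j$ consecutive entries equal to $1$. Then for every positive integer $k$, in $\mathbb{R}[t]$: if $k$ is odd, $$\sum_{j=0}^{k}(-1)^j\,\zeta^t(2,\{1\}^j)\,\zeta^t(2,\{1\}^{k-j})=0,$$ and if $k$ is even, $$\begin{aligned}\sum_{j=0}^{k}(-1)^j\,\zeta^t(2,\{1\}^j)\,\zeta^t(2,\{1\}^{k-j})=2\Bigg(&\sum_{\substack{a_1+\dots+a_{k+2}=1\\ a_1,\dots,a_{k+2}\ge 0}}(a_{k+2}+1)\,\zeta^t(a_{k+2}+2,\,a_1+1,\dots,a_{k+1}+1)\\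 &+t\sum_{i=0}^{k-1}\big(2(-1)^i-1\big)\,\zeta^t(2,\{1\}^i,3,\{1\}^{k-i-1})-3t\,\zeta^t(4,\{1\}^k)\Bigg),\end{aligned}$$ where $a_1,\dots,a_{k+2}$ are integers. -/

import Mathlib

open Polynomial

namespace IMZV

/-- The multiple zeta value
`ζ(l₁, …, lₙ) = ∑_{m₁ > ⋯ > mₙ ≥ 1} 1 / (m₁ ^ l₁ ⋯ mₙ ^ lₙ)` of an index `l = [l₁, …, lₙ]`.
The series (of nonnegative terms) converges when all `lᵢ ≥ 1` and `l₁ ≥ 2`; only such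
indices are used. -/
noncomputable def mzv (l : List ℕ) : ℝ :=
  ∑' m : {m : Fin l.length → ℕ // StrictAnti m ∧ ∀ i, 1 ≤ m i},
    1 / ∏ i : Fin l.length, (m.1 i : ℝ) ^ l.get i

/-- All indices `a □ l₁ □ ⋯ □ lₙ`, where each `□` is either a comma or a plus sign
(one list entry for each of the `2 ^ n` ways of filling the boxes). -/
def boxFillings (a : ℕ) : List ℕ → List (List ℕ)
  | [] => [[a]]
  | b :: l => (boxFillings b l).map (fun p => a :: p) ++ boxFillings (a + b) l

/-- The interpolated multiple zeta value
`ζ^t(l₁, …, lₙ) = ∑_{p = (l₁ □ ⋯ □ lₙ)} t ^ (n - dep p) ζ(p)`, a polynomial in `ℝ[t]`;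
the variable `t` is `Polynomial.X`, and the depth of `p` is its length. -/
noncomputable def imzv : List ℕ → ℝ[X]
  | [] => 1
  | a :: l =>
      ((boxFillings a l).map fun p => X ^ ((a :: l).length - p.length) * C (mzv p)).sum

end IMZV

open IMZV

namespace IMZV

open scoped ENNReal
open Finset.HasAntidiagonal (antidiagonal)

/-! For real `t ≥ 0`, `ζ^t` at `t` is a sum over weakly decreasing tuples with a factor `t` per
equality. Grouping by the largest entry `n` gives `levelSum`, whose generating series in `s` is an
iterated integral in the letters x = ds/s, y = ds/(1-s) and z = y + tx: (2,{1}^j) becomes the word x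
z^j y, and `ζ^t` is the value at s = 1.

For odd `k`, the reflection j ↦ k - j changes the sign of the sum. For even `k`, the shuffle product
(the Leibniz rule, `weightInt_mul_weightInt`) turns the sum into 2 x A_k, where A_k = `altSum` is
the alternating sum of the shuffles of z^i y with x z^(k-i) y (`sum_levelSeries_mul`). Sorting
shuffles by first letter, most terms telescope, which leaves a recursion for A_k (`altSum_succ`).
Substituting y = z - tx and inducting gives the closed form `altSum_eq`, whose words, prefixed by x,
are the indices on the right-hand side. Equality for all `t ≥ 0` gives equality of polynomials. -/

/-- The contribution of the tuples with largest entry `n` to the interpolated multiple zeta value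
of the index `l`, with the variable specialised to the real number `t`. -/
noncomputable def levelSum (t : ℝ) : List ℕ → ℕ → ℝ
  | [], n => if n = 0 then 1 else 0
  | a :: l, n => ((n : ℝ) ^ a)⁻¹ * (∑ m ∈ Finset.range n, levelSum t l m + t * levelSum t l n)

lemma levelSum_cons (t : ℝ) (a : ℕ) (l : List ℕ) (n : ℕ) :
    levelSum t (a :: l) n =
      ((n : ℝ) ^ a)⁻¹ * (∑ m ∈ Finset.range n, levelSum t l m + t * levelSum t l n) := rfl

lemma levelSum_nonneg {t : ℝ} (ht : 0 ≤ t) (l : List ℕ) (n : ℕ) : 0 ≤ levelSum t l n := by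
  induction l generalizing n with
  | nil => unfold levelSum; split_ifs <;> norm_num
  | cons a l ih =>
    unfold levelSum
    have := Finset.sum_nonneg (s := Finset.range n) fun m _ => ih m
    have := ih n
    positivity

lemma levelSum_zero (t : ℝ) {a : ℕ} (ha : 1 ≤ a) (l : List ℕ) : levelSum t (a :: l) 0 = 0 := by
  unfold levelSum
  simp [show a ≠ 0 by omega]

/-- Used in three ways: to merge exponents at a "+", to gain decay for convergence, and to prepend
the letter x. -/
lemma levelSum_add (t : ℝ) (a b : ℕ) (l : List ℕ) (n : ℕ) :
    levelSum t ((a + b) :: l) n = ((n : ℝ) ^ a)⁻¹ * levelSum t (b :: l) n := by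
  simp only [levelSum, pow_add, mul_inv]
  ring

/-! ### Growth bounds and convergence -/

lemma sum_range_succ_inv_sqrt_le (n : ℕ) :
    ∑ m ∈ Finset.range (n + 1), (√(m : ℝ))⁻¹ ≤ 2 * √(n : ℝ) := by
  induction n with
  | zero => simp
  | succ n ih =>
    rw [Finset.sum_range_succ]
    push_cast
    have h1 : 0 < √((n : ℝ) + 1) := Real.sqrt_pos.2 (by positivity)
    have e0 : √(n : ℝ) ^ 2 = n := Real.sq_sqrt (by positivity)
    have e1 : √((n : ℝ) + 1) ^ 2 = n + 1 := Real.sq_sqrt (by positivity)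
    have : (√((n : ℝ) + 1))⁻¹ ≤ 2 * (√((n : ℝ) + 1) - √(n : ℝ)) := by
      rw [inv_le_iff_one_le_mul₀ h1]
      -- With b = √(n+1) and a = √n, 2b(b - a) = 1 + (b - a)².
      nlinarith [sq_nonneg (√((n : ℝ) + 1) - √(n : ℝ))]
    linarith

lemma sum_range_inv_sqrt_le (n : ℕ) :
    ∑ m ∈ Finset.range n, (√(m : ℝ))⁻¹ ≤ 2 * √(n : ℝ) := by
  rcases n with _ | n
  · simp
  · refine (sum_range_succ_inv_sqrt_le n).trans ?_
    gcongr
    simp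

lemma levelSum_partial_le {t C : ℝ} (ht : 0 ≤ t) (l : List ℕ)
    (h : ∀ n : ℕ, 1 ≤ n → levelSum t l n ≤ C * (√(n : ℝ))⁻¹) (h0 : levelSum t l 0 ≤ C)
    (hC : 0 ≤ C) (n : ℕ) (hn : 1 ≤ n) :
    ∑ m ∈ Finset.range n, levelSum t l m + t * levelSum t l n ≤ (3 * C + t * C) * √(n : ℝ) := by
  have hs : 1 ≤ √(n : ℝ) := Real.one_le_sqrt.2 (by exact_mod_cast hn)
  have hs' : (√(n : ℝ))⁻¹ ≤ √(n : ℝ) := (inv_le_one_of_one_le₀ hs).trans hs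
  have h1 : ∑ m ∈ Finset.range n, levelSum t l m
      ≤ C + C * ∑ m ∈ Finset.range n, (√(m : ℝ))⁻¹ := by
    obtain ⟨n, rfl⟩ : ∃ j, n = j + 1 := ⟨n - 1, by omega⟩
    rw [Finset.sum_range_succ', Finset.sum_range_succ', mul_add, Finset.mul_sum]
    have : ∑ m ∈ Finset.range n, levelSum t l (m + 1)
        ≤ ∑ m ∈ Finset.range n, C * (√((m + 1 : ℕ) : ℝ))⁻¹ :=
      Finset.sum_le_sum fun m _ => h (m + 1) (by omega)
    simp only [Nat.cast_zero, Real.sqrt_zero, inv_zero, mul_zero, add_zero]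
    linarith
  have h2 := mul_le_mul_of_nonneg_left (sum_range_inv_sqrt_le n) hC
  have h3 : t * levelSum t l n ≤ t * (C * √(n : ℝ)) :=
    mul_le_mul_of_nonneg_left ((h n hn).trans (mul_le_mul_of_nonneg_left hs' hC)) ht
  -- The `3 * C` is `C` for the term `m = 0`, where the bound with `(√m)⁻¹` says nothing, plus `2 *
  -- C` for the others.
  have h4 := mul_le_mul_of_nonneg_left hs hC
  linarith

/-- The rate n^(-1/2) is crude but stable under the recursion: partial sums grow like √n, and the
factor 1/n restores n^(-1/2). -/
lemma exists_levelSum_le {t : ℝ} (ht : 0 ≤ t) (l : List ℕ) (hl : ∀ a ∈ l, 1 ≤ a) :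
    ∃ C, 0 ≤ C ∧ levelSum t l 0 ≤ C ∧
      ∀ n : ℕ, 1 ≤ n → levelSum t l n ≤ C * (√(n : ℝ))⁻¹ := by
  induction l with
  | nil =>
    refine ⟨1, by norm_num, by simp [levelSum], fun n hn => ?_⟩
    simp only [levelSum, if_neg (show n ≠ 0 by omega)]
    positivity
  | cons a l ih =>
    obtain ⟨C, hC, h0, h⟩ := ih fun b hb => hl b (List.mem_cons_of_mem _ hb)
    have ha : 1 ≤ a := hl a List.mem_cons_self
    refine ⟨3 * C + t * C, by positivity, ?_, fun n hn => ?_⟩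
    · rw [levelSum_zero t ha]; positivity
    · have hp := levelSum_partial_le ht l h h0 hC n hn
      have hn1 : (1 : ℝ) ≤ n := by exact_mod_cast hn
      have hinv : ((n : ℝ) ^ a)⁻¹ ≤ (n : ℝ)⁻¹ := by
        apply inv_anti₀ (by linarith)
        exact le_self_pow₀ hn1 (by omega)
      have hs : (n : ℝ)⁻¹ * √(n : ℝ) = (√(n : ℝ))⁻¹ := by
        have h0 : 0 < √(n : ℝ) := Real.sqrt_pos.2 (by linarith)
        have e0 : √(n : ℝ) * √(n : ℝ) = n := Real.mul_self_sqrt (by linarith)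
        nth_rewrite 1 [← e0]
        field_simp
      calc levelSum t (a :: l) n
          ≤ ((n : ℝ) ^ a)⁻¹ * ((3 * C + t * C) * √(n : ℝ)) := by
            rw [levelSum]; gcongr
        _ ≤ (n : ℝ)⁻¹ * ((3 * C + t * C) * √(n : ℝ)) := by gcongr
        _ = (3 * C + t * C) * (√(n : ℝ))⁻¹ := by rw [← hs]; ring

lemma summable_levelSum {t : ℝ} (ht : 0 ≤ t) {a : ℕ} (ha : 2 ≤ a) (l : List ℕ)
    (hl : ∀ b ∈ l, 1 ≤ b) : Summable (levelSum t (a :: l)) := by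
  obtain ⟨b, rfl⟩ : ∃ b, a = 1 + b := ⟨a - 1, by omega⟩
  obtain ⟨C, hC, -, h⟩ := exists_levelSum_le ht (b :: l) (by
    intro c hc
    rcases List.mem_cons.1 hc with rfl | hc
    · omega
    · exact hl c hc)
  have hs : Summable fun n : ℕ => C * ((n : ℝ) ^ (3 / 2 : ℝ))⁻¹ :=
    (Real.summable_nat_rpow_inv.2 (by norm_num)).mul_left C
  refine hs.of_nonneg_of_le (levelSum_nonneg ht _) fun n => ?_
  rcases Nat.eq_zero_or_pos n with rfl | hn
  · rw [levelSum_zero t (by omega)]; positivity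
  · have hn' : (0 : ℝ) < n := by exact_mod_cast hn
    have e : ((n : ℝ) ^ (3 / 2 : ℝ))⁻¹ = ((n : ℝ) ^ 1)⁻¹ * (√(n : ℝ))⁻¹ := by
      rw [Real.sqrt_eq_rpow, ← mul_inv, pow_one]
      nth_rewrite 2 [← Real.rpow_one (n : ℝ)]
      rw [← Real.rpow_add hn']
      norm_num
    rw [levelSum_add, e]
    calc _ ≤ ((n : ℝ) ^ 1)⁻¹ * (C * (√(n : ℝ))⁻¹) := by gcongr; exact h n hn
      _ = _ := by ring

/-! ### From the multiple series to the level sums -/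

lemma strictAnti_cons_iff {k n : ℕ} {m : Fin k → ℕ} :
    StrictAnti (Fin.cons n m : Fin (k + 1) → ℕ) ↔ (∀ i, m i < n) ∧ StrictAnti m := by
  constructor
  · intro h
    refine ⟨fun i => ?_, fun i j hij => ?_⟩
    · simpa using h (Fin.succ_pos i)
    · simpa using h (Fin.succ_lt_succ_iff.2 hij)
  · rintro ⟨h1, h2⟩ i j hij
    cases j using Fin.cases with
    | zero => exact absurd hij (Fin.not_lt_zero i)
    | succ j =>
      cases i using Fin.cases with
      | zero => simpa using h1 j
      | succ i => simpa using h2 (Fin.succ_lt_succ_iff.1 hij)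

open Classical in
/-- The multiple zeta series restricted to tuples with entries below `N`. -/
noncomputable def truncSum (l : List ℕ) (N : ℕ∞) : ℝ≥0∞ :=
  ∑' m : Fin l.length → ℕ, if StrictAnti m ∧ ∀ i, 1 ≤ m i ∧ (m i : ℕ∞) < N then
    ENNReal.ofReal (1 / ∏ i : Fin l.length, (m i : ℝ) ^ l.get i) else 0

lemma truncSum_nil (N : ℕ∞) : truncSum [] N = 1 := by
  unfold truncSum
  rw [tsum_eq_single (fun i : Fin ([] : List ℕ).length => (i.elim0 : ℕ))]
  · rw [if_pos ⟨fun i => i.elim0, fun i => i.elim0⟩]; simp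
  · intro m hm; exact absurd (_root_.funext fun i => i.elim0) hm

open Classical in
-- Splits off the largest entry `n`, which then bounds the remaining ones. In `ℝ≥0∞` the sum over
-- pairs becomes iterated with no summability condition; `N : ℕ∞` covers both the full series and
-- its truncations.
lemma truncSum_cons (a : ℕ) (l : List ℕ) (N : ℕ∞) :
    truncSum (a :: l) N = ∑' n : ℕ, if 1 ≤ n ∧ (n : ℕ∞) < N then
      ENNReal.ofReal (((n : ℝ) ^ a)⁻¹) * truncSum l n else 0 := by
  have e : truncSum (a :: l) N = ∑' p : ℕ × (Fin l.length → ℕ),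
      (if (1 ≤ p.1 ∧ (p.1 : ℕ∞) < N) then ENNReal.ofReal (((p.1 : ℝ) ^ a)⁻¹) *
        (if StrictAnti p.2 ∧ ∀ i, 1 ≤ p.2 i ∧ (p.2 i : ℕ∞) < (p.1 : ℕ∞) then
          ENNReal.ofReal (1 / ∏ i : Fin l.length, (p.2 i : ℝ) ^ l.get i) else 0) else 0) := by
    refine ((Fin.consEquiv fun _ : Fin (l.length + 1) => ℕ).tsum_eq _).symm.trans ?_
    refine tsum_congr fun ⟨n, m⟩ => ?_
    have hP : (StrictAnti (Fin.cons n m : Fin (l.length + 1) → ℕ) ∧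
        ∀ i, 1 ≤ (Fin.cons n m : Fin (l.length + 1) → ℕ) i ∧
          (((Fin.cons n m : Fin (l.length + 1) → ℕ) i : ℕ) : ℕ∞) < N) ↔
        (1 ≤ n ∧ (n : ℕ∞) < N) ∧
          (StrictAnti m ∧ ∀ i, 1 ≤ m i ∧ (m i : ℕ∞) < (n : ℕ∞)) := by
      rw [strictAnti_cons_iff, Fin.forall_fin_succ]
      simp only [Fin.cons_zero, Fin.cons_succ, Nat.cast_lt]
      constructor
      · rintro ⟨⟨h1, h2⟩, h3, h4⟩
        exact ⟨h3, h2, fun i => ⟨(h4 i).1, h1 i⟩⟩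
      · rintro ⟨h3, h2, h4⟩
        exact ⟨⟨fun i => (h4 i).2, h2⟩, h3, fun i => ⟨(h4 i).1,
          lt_trans (by exact_mod_cast (h4 i).2) h3.2⟩⟩
    have hv : (1 / ∏ i : Fin (l.length + 1),
        ((Fin.cons n m : Fin (l.length + 1) → ℕ) i : ℝ) ^ (a :: l).get i)
        = ((n : ℝ) ^ a)⁻¹ * (1 / ∏ i : Fin l.length, (m i : ℝ) ^ l.get i) := by
      rw [Fin.prod_univ_succ]
      simp [mul_comm]
    change (if StrictAnti (Fin.cons n m : Fin (l.length + 1) → ℕ) ∧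
        ∀ i, 1 ≤ (Fin.cons n m : Fin (l.length + 1) → ℕ) i ∧
          (((Fin.cons n m : Fin (l.length + 1) → ℕ) i : ℕ) : ℕ∞) < N then
      ENNReal.ofReal (1 / ∏ i : Fin (l.length + 1),
        ((Fin.cons n m : Fin (l.length + 1) → ℕ) i : ℝ) ^ (a :: l).get i) else 0) = _
    rw [hv, ENNReal.ofReal_mul (by positivity)]
    by_cases h1 : 1 ≤ n ∧ (n : ℕ∞) < N
    · by_cases h2 : StrictAnti m ∧ ∀ i, 1 ≤ m i ∧ (m i : ℕ∞) < (n : ℕ∞)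
      · rw [if_pos (hP.2 ⟨h1, h2⟩), if_pos h1, if_pos h2]
      · rw [if_neg (fun h => h2 (hP.1 h).2), if_pos h1, if_neg h2, mul_zero]
    · rw [if_neg (fun h => h1 (hP.1 h).1), if_neg h1]
  rw [e, ENNReal.tsum_prod']
  refine tsum_congr fun n => ?_
  by_cases h1 : 1 ≤ n ∧ (n : ℕ∞) < N
  · simp only [if_pos h1, ENNReal.tsum_mul_left, truncSum]
  · simp only [if_neg h1, tsum_zero]

lemma truncSum_cons_eq {a : ℕ} {l : List ℕ} (ha : 1 ≤ a)
    (h : ∀ n : ℕ, 1 ≤ n → truncSum l n = ENNReal.ofReal (∑ m ∈ Finset.range n, levelSum 0 l m))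
    (N : ℕ∞) :
    truncSum (a :: l) N = ∑' n : ℕ, if (n : ℕ∞) < N then
      ENNReal.ofReal (levelSum 0 (a :: l) n) else 0 := by
  rw [truncSum_cons]
  refine tsum_congr fun n => ?_
  rcases Nat.eq_zero_or_pos n with rfl | hn
  · simp [levelSum_zero 0 ha]
  · have hn' : 1 ≤ n := hn
    simp only [hn', true_and]
    rw [h n hn, ← ENNReal.ofReal_mul (by positivity)]
    simp [levelSum]

lemma truncSum_natCast {l : List ℕ} (hl : ∀ a ∈ l, 1 ≤ a) {n : ℕ} (hn : 1 ≤ n) :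
    truncSum l n = ENNReal.ofReal (∑ m ∈ Finset.range n, levelSum 0 l m) := by
  induction l generalizing n with
  | nil =>
    rw [truncSum_nil]
    simp [levelSum, show 0 < n by omega]
  | cons a l ih =>
    rw [truncSum_cons_eq (hl a List.mem_cons_self)
      (fun n hn => ih (fun b hb => hl b (List.mem_cons_of_mem _ hb)) hn),
      ENNReal.ofReal_sum_of_nonneg fun m _ => levelSum_nonneg le_rfl _ m,
      tsum_eq_sum (s := Finset.range n)]
    · refine Finset.sum_congr rfl fun m hm => if_pos ?_
      exact_mod_cast Finset.mem_range.1 hm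
    · intro m hm
      refine if_neg fun h => hm (Finset.mem_range.2 ?_)
      exact_mod_cast h

lemma mzv_eq_toReal_truncSum (l : List ℕ) : mzv l = (truncSum l ⊤).toReal := by
  classical
  have e : truncSum l ⊤ = ∑' m : {m : Fin l.length → ℕ // StrictAnti m ∧ ∀ i, 1 ≤ m i},
      ENNReal.ofReal (1 / ∏ i : Fin l.length, (m.1 i : ℝ) ^ l.get i) := by
    unfold truncSum
    refine Eq.trans ?_ (tsum_subtype {m : Fin l.length → ℕ | StrictAnti m ∧ ∀ i, 1 ≤ m i}
      fun m => ENNReal.ofReal (1 / ∏ i : Fin l.length, (m i : ℝ) ^ l.get i)).symm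
    refine tsum_congr fun m => ?_
    simp [Set.indicator_apply]
  rw [e, ENNReal.tsum_toReal_eq fun _ => ENNReal.ofReal_ne_top]
  refine tsum_congr fun m => ?_
  rw [ENNReal.toReal_ofReal (by positivity)]

lemma mzv_eq_tsum_levelSum {a : ℕ} {l : List ℕ} (hl : ∀ b ∈ a :: l, 1 ≤ b) :
    mzv (a :: l) = ∑' n, levelSum 0 (a :: l) n := by
  rw [mzv_eq_toReal_truncSum, truncSum_cons_eq (hl a List.mem_cons_self)
    fun n hn => truncSum_natCast (fun b hb => hl b (List.mem_cons_of_mem _ hb)) hn]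
  simp only [ENat.natCast_lt_top, if_true]
  rw [ENNReal.tsum_toReal_eq fun _ => ENNReal.ofReal_ne_top]
  exact tsum_congr fun n => ENNReal.toReal_ofReal (levelSum_nonneg le_rfl _ n)

lemma boxFillings_spec (a : ℕ) (l : List ℕ) (ha : 1 ≤ a) (hl : ∀ b ∈ l, 1 ≤ b) :
    ∀ p ∈ boxFillings a l, p.length ≤ l.length + 1 ∧
      ∃ c q, p = c :: q ∧ a ≤ c ∧ ∀ b ∈ q, 1 ≤ b := by
  induction l generalizing a with
  | nil => intro p hp; simp [boxFillings] at hp; subst hp; simp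
  | cons b l ih =>
    have hb : 1 ≤ b := hl b List.mem_cons_self
    have hl' : ∀ c ∈ l, 1 ≤ c := fun c hc => hl c (List.mem_cons_of_mem _ hc)
    intro p hp
    rw [boxFillings, List.mem_append, List.mem_map] at hp
    rcases hp with ⟨q, hq, rfl⟩ | hp
    · obtain ⟨h1, c, r, rfl, h2, h3⟩ := ih b hb hl' q hq
      refine ⟨by simpa using h1, a, c :: r, rfl, le_rfl, fun d hd => ?_⟩
      rcases List.mem_cons.1 hd with rfl | hd
      · omega
      · exact h3 d hd
    · obtain ⟨h1, c, r, rfl, h2, h3⟩ := ih (a + b) (by omega) hl' p hp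
      exact ⟨by simp at h1 ⊢; omega, c, r, rfl, by omega, h3⟩

lemma list_sum_map_mul_sum {α : Type*} (L : List α) (c : α → ℝ) (K : ℝ) (s : Finset ℕ)
    (f : α → ℕ → ℝ) : (L.map fun p => c p * (K * ∑ m ∈ s, f p m)).sum
      = K * ∑ m ∈ s, (L.map fun p => c p * f p m).sum := by
  induction L with
  | nil => simp
  | cons p L ih =>
    simp only [List.map_cons, List.sum_cons, ih, Finset.sum_add_distrib, ← Finset.mul_sum]
    ring

/-- A comma is the strict part `m < n` of the recursion, a plus is the diagonal part, which merges
two exponents at the price of one `t`. -/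
lemma levelSum_eq_sum_boxFillings (t : ℝ) (a : ℕ) (l : List ℕ) (ha : 1 ≤ a)
    (hl : ∀ b ∈ l, 1 ≤ b) (n : ℕ) :
    levelSum t (a :: l) n = ((boxFillings a l).map fun p =>
      t ^ ((a :: l).length - p.length) * levelSum 0 p n).sum := by
  induction l generalizing a n with
  | nil =>
    rcases Nat.eq_zero_or_pos n with rfl | hn
    · simp [boxFillings, levelSum_zero _ ha]
    · simp [boxFillings, levelSum, hn.ne']
  | cons b l ih =>
    have hb : 1 ≤ b := hl b List.mem_cons_self
    have hl' : ∀ c ∈ l, 1 ≤ c := fun c hc => hl c (List.mem_cons_of_mem _ hc)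
    have h1 : ((boxFillings b l).map fun p => t ^ ((a :: b :: l).length - (a :: p).length) *
        levelSum 0 (a :: p) n).sum
        = ((n : ℝ) ^ a)⁻¹ * ∑ m ∈ Finset.range n, levelSum t (b :: l) m := by
      simp only [levelSum_cons 0 a, zero_mul, add_zero, ih b hb hl', ← list_sum_map_mul_sum,
        List.length_cons, Nat.add_sub_add_right]
    have h2 : ((boxFillings (a + b) l).map fun p => t ^ ((a :: b :: l).length - p.length) *
        levelSum 0 p n).sum = t * levelSum t ((a + b) :: l) n := by
      rw [ih (a + b) (by omega) hl', ← List.sum_map_mul_left]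
      congr 1
      refine List.map_congr_left fun p hp => ?_
      -- The length bound keeps the natural subtraction in the exponent of `t` from truncating.
      have := (boxFillings_spec (a + b) l (by omega) hl' p hp).1
      rw [List.length_cons, List.length_cons, List.length_cons,
        show l.length + 1 + 1 - p.length = (l.length + 1 - p.length) + 1 by omega]
      ring
    rw [boxFillings, List.map_append, List.sum_append, List.map_map]
    refine Eq.trans ?_ (congrArg₂ (· + ·) h1 h2).symm
    rw [levelSum_add, levelSum_cons t a (b :: l)]
    ring

lemma eval_imzv (t : ℝ) {a : ℕ} {l : List ℕ} (ha : 2 ≤ a) (hl : ∀ b ∈ l, 1 ≤ b) :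
    (imzv (a :: l)).eval t = ∑' n, levelSum t (a :: l) n := by
  have key : ∀ L : List (List ℕ), (∀ p ∈ L, ∃ c q, p = c :: q ∧ a ≤ c ∧ ∀ b ∈ q, 1 ≤ b) →
      HasSum (fun n => (L.map fun p =>
        t ^ ((a :: l).length - p.length) * levelSum 0 p n).sum)
      ((L.map fun p : List ℕ => (X : ℝ[X]) ^ ((a :: l).length - p.length) * C (mzv p)).sum.eval t) := by
    intro L hL
    induction L with
    | nil => simp [hasSum_zero]
    | cons p L ih =>
      obtain ⟨c, q, rfl, hc, hq⟩ := hL p List.mem_cons_self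
      simp only [List.map_cons, List.sum_cons, eval_add, eval_mul, eval_pow, eval_X, eval_C]
      refine HasSum.add (HasSum.mul_left _ ?_) (ih fun r hr => hL r (List.mem_cons_of_mem _ hr))
      rw [mzv_eq_tsum_levelSum (by
        intro b hb
        rcases List.mem_cons.1 hb with rfl | hb
        · omega
        · exact hq b hb)]
      exact (summable_levelSum le_rfl (by omega) q hq).hasSum
  rw [imzv, ← (key _ fun p hp => (boxFillings_spec a l (by omega) hl p hp).2).tsum_eq]
  exact tsum_congr fun n => (levelSum_eq_sum_boxFillings t a l (by omega) hl n).symm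

/-! ### Formal iterated integrals and the shuffle product -/

/-- The formal integral `∫ u f ds / s`, i.e. the power series with coefficients `[sⁿ](u f) / n`. -/
noncomputable def weightInt (u : PowerSeries ℝ) : PowerSeries ℝ →ₗ[ℝ] PowerSeries ℝ where
  toFun f := PowerSeries.mk fun n => (n : ℝ)⁻¹ * PowerSeries.coeff n (u * f)
  map_add' f g := by ext n; simp [mul_add]
  map_smul' c f := by ext n; simp [mul_left_comm]

lemma coeff_weightInt (u f : PowerSeries ℝ) (n : ℕ) :
    PowerSeries.coeff n (weightInt u f) = (n : ℝ)⁻¹ * PowerSeries.coeff n (u * f) := by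
  simp [weightInt]

lemma constantCoeff_weightInt (u f : PowerSeries ℝ) :
    PowerSeries.constantCoeff (weightInt u f) = 0 := by
  rw [← PowerSeries.coeff_zero_eq_constantCoeff_apply, coeff_weightInt]; simp

lemma X_mul_derivative_weightInt {u f : PowerSeries ℝ}
    (h : PowerSeries.constantCoeff (u * f) = 0) :
    PowerSeries.X * PowerSeries.derivative ℝ (weightInt u f) = u * f := by
  ext n
  rcases n with _ | n
  · rw [← PowerSeries.coeff_zero_eq_constantCoeff_apply] at h
    simp [h]
  · rw [PowerSeries.coeff_succ_X_mul, PowerSeries.coeff_derivative,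
      coeff_weightInt]
    have : ((n : ℝ) + 1) ≠ 0 := by positivity
    push_cast
    field_simp

lemma eq_of_X_mul_derivative_eq {f g : PowerSeries ℝ}
    (h : PowerSeries.X * PowerSeries.derivative ℝ f = PowerSeries.X * PowerSeries.derivative ℝ g)
    (h0 : PowerSeries.constantCoeff f = PowerSeries.constantCoeff g) : f = g :=
  PowerSeries.derivative.ext (mul_left_cancel₀ PowerSeries.X_ne_zero h) h0

/-- The shuffle product formula for iterated formal integrals. -/
lemma weightInt_mul_weightInt {u v f g : PowerSeries ℝ}
    (hf : PowerSeries.constantCoeff (u * f) = 0) (hg : PowerSeries.constantCoeff (v * g) = 0) :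
    weightInt u f * weightInt v g
      = weightInt u (f * weightInt v g) + weightInt v (weightInt u f * g) := by
  apply eq_of_X_mul_derivative_eq
  -- Both sides have the same image under s d/ds, by the Leibniz rule, and no constant term.
  · rw [map_add, mul_add, X_mul_derivative_weightInt (by
      rw [← mul_assoc, map_mul, hf, zero_mul]), X_mul_derivative_weightInt (by
      rw [mul_left_comm, map_mul, hg, mul_zero]), Derivation.leibniz]
    simp only [smul_eq_mul]
    rw [mul_add, mul_left_comm, X_mul_derivative_weightInt hg,
      mul_left_comm PowerSeries.X, X_mul_derivative_weightInt hf]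
    ring
  · simp [constantCoeff_weightInt]

/-- The power series `s / (1 - s)`. -/
noncomputable def geom : PowerSeries ℝ := PowerSeries.X * PowerSeries.mk fun _ => 1

lemma constantCoeff_geom : PowerSeries.constantCoeff geom = 0 := by simp [geom]

lemma coeff_geom_mul (f : PowerSeries ℝ) (n : ℕ) :
    PowerSeries.coeff n (geom * f) = ∑ m ∈ Finset.range n, PowerSeries.coeff m f := by
  rcases n with _ | n
  · simp [geom]
  · rw [geom, mul_assoc, PowerSeries.coeff_succ_X_mul, mul_comm, PowerSeries.coeff_mul,
      Finset.Nat.sum_antidiagonal_eq_sum_range_succ_mk]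
    simp

/-! ### Indices as words in x, y, z -/

/-- The generating series of `levelSum`. -/
noncomputable def levelSeries (t : ℝ) (l : List ℕ) : PowerSeries ℝ :=
  PowerSeries.mk (levelSum t l)

/-- Integration against `ds / s`. -/
noncomputable abbrev intX : PowerSeries ℝ →ₗ[ℝ] PowerSeries ℝ := weightInt 1

/-- Integration against `ds / (1 - s)`. -/
noncomputable abbrev intY : PowerSeries ℝ →ₗ[ℝ] PowerSeries ℝ := weightInt geom

/-- Integration against `ds / (1 - s) + t ds / s`. -/
noncomputable abbrev intZ (t : ℝ) : PowerSeries ℝ →ₗ[ℝ] PowerSeries ℝ :=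
  weightInt (geom + PowerSeries.C t)

lemma intY_eq (t : ℝ) (f : PowerSeries ℝ) : intY f = intZ t f - t • intX f := by
  ext n
  simp only [coeff_weightInt, map_sub, add_mul, map_add, one_mul, PowerSeries.coeff_C_mul,
    PowerSeries.coeff_smul, smul_eq_mul]
  ring

lemma levelSeries_one_cons (t : ℝ) (l : List ℕ) :
    levelSeries t (1 :: l) = intZ t (levelSeries t l) := by
  ext n
  simp [coeff_weightInt, add_mul, coeff_geom_mul, levelSeries, levelSum_cons]

lemma levelSeries_add_one_cons (t : ℝ) (a : ℕ) (l : List ℕ) :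
    levelSeries t ((a + 1) :: l) = intX (levelSeries t (a :: l)) := by
  ext n
  simp [coeff_weightInt, levelSeries, add_comm a 1, levelSum_add]

lemma levelSeries_singleton_one (t : ℝ) : levelSeries t [1] = intY 1 := by
  have h1 : levelSeries t [] = 1 := by
    ext n; simp [levelSeries, levelSum, PowerSeries.coeff_one]
  rw [levelSeries_one_cons, h1, intY_eq t]
  -- The only nonzero coefficient of `1` is at `n = 0`, where `(0 : ℝ)⁻¹ = 0`; so z and y agree as
  -- the last letter.
  have : intX 1 = 0 := by
    ext n
    rcases n with _ | n <;> simp [coeff_weightInt, PowerSeries.coeff_one]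
  rw [this]; simp

/-- The series of the index `{1}^(k+1)`. -/
noncomputable def onesSeries (t : ℝ) (k : ℕ) : PowerSeries ℝ :=
  levelSeries t (List.replicate (k + 1) 1)

lemma onesSeries_zero (t : ℝ) : onesSeries t 0 = intY 1 := levelSeries_singleton_one t

lemma onesSeries_succ (t : ℝ) (k : ℕ) : onesSeries t (k + 1) = intZ t (onesSeries t k) :=
  levelSeries_one_cons t _

lemma constantCoeff_onesSeries (t : ℝ) (k : ℕ) :
    PowerSeries.constantCoeff (onesSeries t k) = 0 := by
  cases k with
  | zero => rw [onesSeries_zero, constantCoeff_weightInt]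
  | succ k => rw [onesSeries_succ, constantCoeff_weightInt]

/-- `onesSeries` with the index lowered by one, and `0` at index `0`. -/
noncomputable def prevOnesSeries (t : ℝ) : ℕ → PowerSeries ℝ
  | 0 => 0
  | k + 1 => onesSeries t k

/-- Shuffles of z^i y with a word beginning with `u`, sorted by first letter. The first word
contributes z if `i > 0` and y if `i = 0`, hence the extra term. -/
lemma onesSeries_mul_weightInt (t : ℝ) (i : ℕ) {u g : PowerSeries ℝ}
    (hg : PowerSeries.constantCoeff (u * g) = 0) :
    onesSeries t i * weightInt u g = weightInt u (onesSeries t i * g)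
      + intZ t (prevOnesSeries t i * weightInt u g)
      + if i = 0 then intY (weightInt u g) else 0 := by
  cases i with
  | zero =>
    rw [onesSeries_zero, weightInt_mul_weightInt (by simp [constantCoeff_geom]) hg]
    simp [prevOnesSeries, add_comm]
  | succ i =>
    rw [onesSeries_succ, weightInt_mul_weightInt (by simp [constantCoeff_onesSeries]) hg]
    simp [prevOnesSeries, add_comm]

lemma onesSeries_mul_onesSeries (t : ℝ) (i j : ℕ) :
    onesSeries t i * onesSeries t j = intZ t (onesSeries t i * prevOnesSeries t j)
      + intZ t (prevOnesSeries t i * onesSeries t j)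
      + ((if i = 0 then intY (onesSeries t j) else 0)
        + if j = 0 then intY (onesSeries t i) else 0) := by
  cases j with
  | zero =>
    rw [onesSeries_zero, onesSeries_mul_weightInt t i (by simp [constantCoeff_geom])]
    simp only [prevOnesSeries, mul_zero, map_zero, mul_one, if_true]
    abel
  | succ j =>
    rw [onesSeries_succ, onesSeries_mul_weightInt t i (by simp [constantCoeff_onesSeries])]
    simp [prevOnesSeries]

/-- Shuffles beginning with z cancel in pairs, since taking z from the left or the right factor
leaves the same products with opposite signs. Only the y-terms at the two ends survive. -/
lemma sum_onesSeries_mul_onesSeries (t : ℝ) (k : ℕ) :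
    ∑ p ∈ antidiagonal k, (-1 : ℝ) ^ p.1 • (onesSeries t p.1 * onesSeries t p.2)
      = (1 + (-1 : ℝ) ^ k) • intY (onesSeries t k) := by
  rcases k with _ | k
  · rw [Finset.Nat.antidiagonal_zero, Finset.sum_singleton, onesSeries_mul_onesSeries]
    simp only [prevOnesSeries, pow_zero, one_smul, mul_zero, zero_mul, map_zero, if_true,
      zero_add, add_smul]
  · have h1 : ∑ p ∈ antidiagonal (k + 1),
        (-1 : ℝ) ^ p.1 • intZ t (onesSeries t p.1 * prevOnesSeries t p.2)
        = ∑ p ∈ antidiagonal k,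
          (-1 : ℝ) ^ p.1 • intZ t (onesSeries t p.1 * onesSeries t p.2) := by
      rw [Finset.Nat.sum_antidiagonal_succ']
      simp [prevOnesSeries]
    have h2 : ∑ p ∈ antidiagonal (k + 1),
        (-1 : ℝ) ^ p.1 • intZ t (prevOnesSeries t p.1 * onesSeries t p.2)
        = -∑ p ∈ antidiagonal k,
          (-1 : ℝ) ^ p.1 • intZ t (onesSeries t p.1 * onesSeries t p.2) := by
      rw [Finset.Nat.sum_antidiagonal_succ]
      simp [prevOnesSeries, pow_succ, Finset.sum_neg_distrib]
    have h3 : ∑ p ∈ antidiagonal (k + 1),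
        (-1 : ℝ) ^ p.1 • (if p.1 = 0 then intY (onesSeries t p.2) else 0)
        = intY (onesSeries t (k + 1)) := by
      rw [Finset.Nat.sum_antidiagonal_succ]
      simp
    have h4 : ∑ p ∈ antidiagonal (k + 1),
        (-1 : ℝ) ^ p.1 • (if p.2 = 0 then intY (onesSeries t p.1) else 0)
        = (-1 : ℝ) ^ (k + 1) • intY (onesSeries t (k + 1)) := by
      rw [Finset.Nat.sum_antidiagonal_succ']
      simp
    rw [Finset.sum_congr rfl fun p _ => congrArg _ (onesSeries_mul_onesSeries t p.1 p.2)]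
    simp only [smul_add, Finset.sum_add_distrib]
    rw [h1, h2, h3, h4, add_neg_cancel, zero_add, add_smul, one_smul]

/-! ### Recursion and closed form for the alternating sum -/

/-- The alternating sum of the shuffle products of `z ^ i y` and `x z ^ (k - i) y`. -/
noncomputable def altSum (t : ℝ) (k : ℕ) : PowerSeries ℝ :=
  ∑ p ∈ antidiagonal k, (-1 : ℝ) ^ p.1 • (onesSeries t p.1 * intX (onesSeries t p.2))

lemma altSum_eq_add_shifted_sum (t : ℝ) (k : ℕ) :
    altSum t k = (1 + (-1 : ℝ) ^ k) • intX (intY (onesSeries t k))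
      + (∑ p ∈ antidiagonal k,
          (-1 : ℝ) ^ p.1 • intZ t (prevOnesSeries t p.1 * intX (onesSeries t p.2))
        + intY (intX (onesSeries t k))) := by
  have h3 : ∑ p ∈ antidiagonal k,
      (-1 : ℝ) ^ p.1 • (if p.1 = 0 then intY (intX (onesSeries t p.2)) else 0)
      = intY (intX (onesSeries t k)) := by
    rcases k with _ | k
    · simp
    · rw [Finset.Nat.sum_antidiagonal_succ]
      simp
  rw [altSum, Finset.sum_congr rfl fun p _ => congrArg _
    (onesSeries_mul_weightInt t p.1 (u := 1) (g := onesSeries t p.2)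
      (by simp [constantCoeff_onesSeries]))]
  simp only [smul_add, Finset.sum_add_distrib]
  rw [h3, ← map_smul, ← sum_onesSeries_mul_onesSeries, map_sum, add_assoc]
  simp only [map_smul]

lemma altSum_zero (t : ℝ) :
    altSum t 0 = (2 : ℝ) • intX (intY (onesSeries t 0)) + intY (intX (onesSeries t 0)) := by
  rw [altSum_eq_add_shifted_sum]
  simp [prevOnesSeries]
  norm_num

/-- Shuffles beginning with x are summed by `sum_onesSeries_mul_onesSeries`; those beginning with z
lower `i` by one, which flips the sign and reproduces `altSum t k`. -/
lemma altSum_succ (t : ℝ) (k : ℕ) :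
    altSum t (k + 1) = (1 + (-1 : ℝ) ^ (k + 1)) • intX (intY (onesSeries t (k + 1)))
      + intY (intX (onesSeries t (k + 1))) - intZ t (altSum t k) := by
  rw [altSum_eq_add_shifted_sum, altSum, Finset.Nat.sum_antidiagonal_succ, map_sum]
  simp [prevOnesSeries, pow_succ, Finset.sum_neg_distrib]
  abel

/-- The series of the word `z ^ a x z ^ (k + 1 - a) y`. -/
noncomputable def wordX (t : ℝ) (k a : ℕ) : PowerSeries ℝ :=
  (intZ t ^ a) (intX (onesSeries t (k + 1 - a)))

/-- The series of the word `z ^ a x x z ^ (k - a) y`. -/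
noncomputable def wordXX (t : ℝ) (k a : ℕ) : PowerSeries ℝ :=
  (intZ t ^ a) (intX (intX (onesSeries t (k - a))))

lemma intZ_wordX (t : ℝ) (k a : ℕ) : intZ t (wordX t k a) = wordX t (k + 1) (a + 1) := by
  rw [wordX, wordX, pow_succ', Module.End.mul_apply, Nat.add_sub_add_right]

lemma intZ_wordXX (t : ℝ) (k a : ℕ) : intZ t (wordXX t k a) = wordXX t (k + 1) (a + 1) := by
  rw [wordXX, wordXX, pow_succ', Module.End.mul_apply, Nat.add_sub_add_right]

lemma altSum_eq (t : ℝ) (k : ℕ) :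
    altSum t k = wordX t k 0 + (-1 : ℝ) ^ k • ∑ a ∈ Finset.range (k + 2), wordX t k a
      - t • ∑ a ∈ Finset.range (k + 1), (2 * (-1 : ℝ) ^ a + (-1) ^ k) • wordXX t k a := by
  induction k with
  | zero =>
    rw [altSum_zero, intY_eq t, intY_eq t, ← onesSeries_succ]
    simp only [Finset.sum_range_succ, Finset.sum_range_zero, wordX, wordXX, pow_zero, pow_one,
      Module.End.one_apply, map_sub, map_smul]
    module
  | succ k ih =>
    have h0 : wordX t (k + 1) 0 = intX (onesSeries t (k + 1 + 1)) := rfl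
    have h1 : intZ t (intX (onesSeries t (k + 1))) = wordX t (k + 1) 1 := intZ_wordX t k 0
    have h2 : intX (intX (onesSeries t (k + 1))) = wordXX t (k + 1) 0 := rfl
    have h3 : ∑ a ∈ Finset.range (k + 1 + 1),
        (2 * (-1 : ℝ) ^ a + (-1) ^ (k + 1)) • wordXX t (k + 1) a
        = -∑ a ∈ Finset.range (k + 1), (2 * (-1 : ℝ) ^ a + (-1) ^ k) • wordXX t (k + 1) (a + 1)
          + (2 + (-1 : ℝ) ^ (k + 1)) • wordXX t (k + 1) 0 := by
      rw [Finset.sum_range_succ', ← Finset.sum_neg_distrib, pow_zero, mul_one]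
      congr 1
      refine Finset.sum_congr rfl fun a _ => ?_
      rw [← neg_smul]
      congr 1
      ring
    have h4 : ∑ a ∈ Finset.range (k + 1 + 2), wordX t (k + 1) a
        = ∑ a ∈ Finset.range (k + 2), wordX t (k + 1) (a + 1) + wordX t (k + 1) 0 :=
      Finset.sum_range_succ' _ (k + 2)
    -- Replacing y by z - tx leaves only words of the two families; applying z to the induction
    -- hypothesis shifts `a` by one, and the new terms supply `a = 0` and correct `a = 1`.
    rw [altSum_succ, ih, intY_eq t, intY_eq t, ← onesSeries_succ, h3, h4]
    simp only [map_sub, map_add, map_smul, map_sum, intZ_wordX, intZ_wordXX]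
    rw [h1, h2, ← h0, pow_succ]
    module

/-- A shuffle of two words beginning with x begins with the x of one of them. For even `k` the signs
at `p.1` and `p.2` agree, so the two halves are equal by symmetry. -/
lemma sum_levelSeries_mul (t : ℝ) {k : ℕ} (hk : Even k) :
    ∑ p ∈ antidiagonal k,
      (-1 : ℝ) ^ p.1 • (intX (onesSeries t p.1) * intX (onesSeries t p.2))
      = (2 : ℝ) • intX (altSum t k) := by
  have h : ∀ p ∈ antidiagonal k,
      (-1 : ℝ) ^ p.1 • (intX (onesSeries t p.1) * intX (onesSeries t p.2))
      = intX ((-1 : ℝ) ^ p.1 • (onesSeries t p.1 * intX (onesSeries t p.2)))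
        + intX ((-1 : ℝ) ^ p.2 • (onesSeries t p.2 * intX (onesSeries t p.1))) := by
    intro p hp
    rw [Finset.HasAntidiagonal.mem_antidiagonal] at hp
    have hs : (-1 : ℝ) ^ p.2 = (-1) ^ p.1 := by
      have : Even (p.1 + p.2) := hp ▸ hk
      rcases Nat.even_or_odd p.1 with h | h
      · rw [h.neg_one_pow, ((Nat.even_add.1 this).1 h).neg_one_pow]
      · rw [h.neg_one_pow, Odd.neg_one_pow]
        rw [← Nat.not_even_iff_odd] at h ⊢
        exact fun h' => h ((Nat.even_add.1 this).2 h')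
    rw [weightInt_mul_weightInt (by simp [constantCoeff_onesSeries])
      (by simp [constantCoeff_onesSeries]), hs, map_smul, map_smul, smul_add,
      mul_comm (onesSeries t p.2)]
  rw [Finset.sum_congr rfl h, Finset.sum_add_distrib, ← map_sum, ← map_sum,
    two_smul, altSum]
  congr 2
  exact Finset.Nat.sum_antidiagonal_swap (n := k) (f := fun p => (-1 : ℝ) ^ p.1 •
    (onesSeries t p.1 * intX (onesSeries t p.2)))

lemma intX_intZ_pow_levelSeries (t : ℝ) (i : ℕ) (l : List ℕ) :
    intX ((intZ t ^ (i + 1)) (levelSeries t l))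
      = levelSeries t (2 :: (List.replicate i 1 ++ l)) := by
  rw [levelSeries_add_one_cons t 1]
  congr 1
  induction i with
  | zero => simp [levelSeries_one_cons]
  | succ i ih =>
    rw [pow_succ', Module.End.mul_apply, ih, ← levelSeries_one_cons, List.replicate_succ]
    rfl

lemma intX_onesSeries (t : ℝ) (j : ℕ) :
    intX (onesSeries t j) = levelSeries t (2 :: List.replicate j 1) :=
  (levelSeries_add_one_cons t 1 _).symm

lemma intX_intX_onesSeries (t : ℝ) (j : ℕ) :
    intX (intX (onesSeries t j)) = levelSeries t (3 :: List.replicate j 1) := by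
  rw [intX_onesSeries, ← levelSeries_add_one_cons]

lemma intX_wordX_zero (t : ℝ) (k : ℕ) :
    intX (wordX t k 0) = levelSeries t (3 :: List.replicate (k + 1) 1) :=
  intX_intX_onesSeries t _

lemma intX_wordX_succ (t : ℝ) (k i : ℕ) :
    intX (wordX t k (i + 1))
      = levelSeries t (2 :: (List.replicate i 1 ++ 2 :: List.replicate (k - i) 1)) := by
  rw [wordX, intX_onesSeries, intX_intZ_pow_levelSeries, Nat.add_sub_add_right]

lemma intX_wordXX_zero (t : ℝ) (k : ℕ) :
    intX (wordXX t k 0) = levelSeries t (4 :: List.replicate k 1) := by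
  rw [wordXX, intX_intX_onesSeries, pow_zero, Module.End.one_apply, ← levelSeries_add_one_cons]
  rfl

lemma intX_wordXX_succ (t : ℝ) (k i : ℕ) :
    intX (wordXX t k (i + 1))
      = levelSeries t (2 :: (List.replicate i 1 ++ 3 :: List.replicate (k - i - 1) 1)) := by
  rw [wordXX, intX_intX_onesSeries, intX_intZ_pow_levelSeries, Nat.sub_sub]

/-! ### Evaluation at s = 1 -/

/-- The coefficients of `f` sum up to `s`. -/
def SumsTo (f : PowerSeries ℝ) (s : ℝ) : Prop := HasSum (fun n => PowerSeries.coeff n f) s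

lemma SumsTo.add {f g : PowerSeries ℝ} {a b : ℝ} (hf : SumsTo f a) (hg : SumsTo g b) :
    SumsTo (f + g) (a + b) := by
  simpa only [SumsTo, map_add] using HasSum.add hf hg

lemma SumsTo.sub {f g : PowerSeries ℝ} {a b : ℝ} (hf : SumsTo f a) (hg : SumsTo g b) :
    SumsTo (f - g) (a - b) := by
  simpa only [SumsTo, map_sub] using HasSum.sub hf hg

lemma SumsTo.smul {f : PowerSeries ℝ} {a : ℝ} (c : ℝ) (hf : SumsTo f a) :
    SumsTo (c • f) (c * a) := by
  simpa only [SumsTo, map_smul, smul_eq_mul] using HasSum.mul_left c hf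

lemma SumsTo.sum {ι : Type*} {s : Finset ι} {f : ι → PowerSeries ℝ} {a : ι → ℝ}
    (h : ∀ i ∈ s, SumsTo (f i) (a i)) : SumsTo (∑ i ∈ s, f i) (∑ i ∈ s, a i) := by
  simpa only [SumsTo, map_sum] using hasSum_sum h

lemma SumsTo.mul {f g : PowerSeries ℝ} {a b : ℝ} (hf : SumsTo f a) (hg : SumsTo g b) :
    SumsTo (f * g) (a * b) := by
  have hf' := (HasSum.summable hf).norm
  have hg' := (HasSum.summable hg).norm
  have h1 := tsum_mul_tsum_eq_tsum_sum_antidiagonal_of_summable_norm hf' hg'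
  have h2 := (summable_norm_sum_mul_antidiagonal_of_summable_norm hf' hg').of_norm
  rw [HasSum.tsum_eq hf, HasSum.tsum_eq hg] at h1
  simpa only [SumsTo, PowerSeries.coeff_mul, h1] using h2.hasSum

lemma sumsTo_levelSeries {t : ℝ} (ht : 0 ≤ t) {a : ℕ} {l : List ℕ} (ha : 2 ≤ a)
    (hl : ∀ b ∈ l, 1 ≤ b) : SumsTo (levelSeries t (a :: l)) ((imzv (a :: l)).eval t) := by
  rw [eval_imzv t ha hl]
  simpa only [SumsTo, levelSeries, PowerSeries.coeff_mk] using (summable_levelSum ht ha l hl).hasSum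

lemma one_le_of_mem_replicate {m b : ℕ} (h : b ∈ List.replicate m 1) : 1 ≤ b :=
  (List.eq_of_mem_replicate h).ge

lemma sumsTo_levelSeries_replicate {t : ℝ} (ht : 0 ≤ t) {a : ℕ} (ha : 2 ≤ a) (m : ℕ) :
    SumsTo (levelSeries t (a :: List.replicate m 1))
      ((imzv (a :: List.replicate m 1)).eval t) :=
  sumsTo_levelSeries ht ha fun _ => one_le_of_mem_replicate

lemma sumsTo_levelSeries_replicate_append {t : ℝ} (ht : 0 ≤ t) (i m : ℕ) {c : ℕ} (hc : 1 ≤ c) :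
    SumsTo (levelSeries t (2 :: (List.replicate i 1 ++ c :: List.replicate m 1)))
      ((imzv (2 :: (List.replicate i 1 ++ c :: List.replicate m 1))).eval t) := by
  refine sumsTo_levelSeries ht le_rfl fun b hb => ?_
  rcases List.mem_append.1 hb with hb | hb
  · exact one_le_of_mem_replicate hb
  · rcases List.mem_cons.1 hb with rfl | hb
    · exact hc
    · exact one_le_of_mem_replicate hb

/-- The value at s = 1 of x times `altSum_eq`. The index (3,{1}^(k+1)) occurs twice, as `wordX t k
0` on its own and inside the sum; the 3 before (4,{1}^k) is 2(-1)^a + 1 at `a = 0`. -/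
lemma eval_sum_imzv_mul_imzv {t : ℝ} (ht : 0 ≤ t) {k : ℕ} (hk : Even k) :
    ∑ j ∈ Finset.range (k + 1), (-1 : ℝ) ^ j * (imzv (2 :: List.replicate j 1)).eval t *
        (imzv (2 :: List.replicate (k - j) 1)).eval t
      = 2 * (2 * (imzv (3 :: List.replicate (k + 1) 1)).eval t
        + ∑ i ∈ Finset.range (k + 1),
            (imzv (2 :: (List.replicate i 1 ++ 2 :: List.replicate (k - i) 1))).eval t
        + t * ∑ i ∈ Finset.range k, (2 * (-1 : ℝ) ^ i - 1) *
            (imzv (2 :: (List.replicate i 1 ++ 3 :: List.replicate (k - i - 1) 1))).eval t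
        - 3 * t * (imzv (4 :: List.replicate k 1)).eval t) := by
  have hL : SumsTo ((2 : ℝ) • intX (altSum t k))
      (∑ j ∈ Finset.range (k + 1), (-1 : ℝ) ^ j * (imzv (2 :: List.replicate j 1)).eval t *
        (imzv (2 :: List.replicate (k - j) 1)).eval t) := by
    rw [← sum_levelSeries_mul t hk, Finset.Nat.sum_antidiagonal_eq_sum_range_succ_mk]
    refine SumsTo.sum fun j _ => ?_
    rw [mul_assoc, intX_onesSeries, intX_onesSeries]
    exact ((sumsTo_levelSeries_replicate ht le_rfl _).mul
      (sumsTo_levelSeries_replicate ht le_rfl _)).smul _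
  have hX : SumsTo (∑ a ∈ Finset.range (k + 2), intX (wordX t k a))
      (∑ i ∈ Finset.range (k + 1),
        (imzv (2 :: (List.replicate i 1 ++ 2 :: List.replicate (k - i) 1))).eval t
        + (imzv (3 :: List.replicate (k + 1) 1)).eval t) := by
    rw [Finset.sum_range_succ', intX_wordX_zero]
    refine (SumsTo.sum fun i _ => ?_).add (sumsTo_levelSeries_replicate ht (by norm_num) _)
    rw [intX_wordX_succ]
    exact sumsTo_levelSeries_replicate_append ht _ _ (by norm_num)
  have hXX : SumsTo (∑ a ∈ Finset.range (k + 1), (2 * (-1 : ℝ) ^ a + 1) • intX (wordXX t k a))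
      (∑ i ∈ Finset.range k, (2 * (-1 : ℝ) ^ (i + 1) + 1) *
        (imzv (2 :: (List.replicate i 1 ++ 3 :: List.replicate (k - i - 1) 1))).eval t
        + (2 * (-1 : ℝ) ^ 0 + 1) * (imzv (4 :: List.replicate k 1)).eval t) := by
    rw [Finset.sum_range_succ', intX_wordXX_zero]
    refine (SumsTo.sum fun i _ => ?_).add
      ((sumsTo_levelSeries_replicate ht (by norm_num) _).smul _)
    rw [intX_wordXX_succ]
    exact (sumsTo_levelSeries_replicate_append ht _ _ (by norm_num)).smul _
  have h0 : SumsTo (intX (wordX t k 0)) ((imzv (3 :: List.replicate (k + 1) 1)).eval t) := by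
    rw [intX_wordX_zero]
    exact sumsTo_levelSeries_replicate ht (by norm_num) _
  have hR := (((h0.add hX).sub (hXX.smul t)).smul 2)
  have e : intX (altSum t k) = intX (wordX t k 0)
      + ∑ a ∈ Finset.range (k + 2), intX (wordX t k a)
      - t • ∑ a ∈ Finset.range (k + 1), (2 * (-1 : ℝ) ^ a + 1) • intX (wordXX t k a) := by
    rw [altSum_eq, hk.neg_one_pow, one_smul]
    simp only [map_sub, map_add, map_sum, map_smul]
  rw [e] at hL
  rw [HasSum.unique hL hR]
  have hs : ∑ i ∈ Finset.range k, (2 * (-1 : ℝ) ^ (i + 1) + 1) *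
        (imzv (2 :: (List.replicate i 1 ++ 3 :: List.replicate (k - i - 1) 1))).eval t
      = -∑ i ∈ Finset.range k, (2 * (-1 : ℝ) ^ i - 1) *
        (imzv (2 :: (List.replicate i 1 ++ 3 :: List.replicate (k - i - 1) 1))).eval t := by
    rw [← Finset.sum_neg_distrib]
    exact Finset.sum_congr rfl fun i _ => by ring
  rw [hs]
  ring

/-! ### Reindexing the right-hand side, and the odd case -/

lemma sum_antidiagonalTuple_one {M : Type*} [AddCommMonoid M] (n : ℕ) (f : (Fin n → ℕ) → M) :
    ∑ a ∈ Finset.Nat.antidiagonalTuple n 1, f a = ∑ i : Fin n, f (Pi.single i 1) := by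
  classical
  have hinj : Function.Injective fun i : Fin n => (Pi.single i 1 : Fin n → ℕ) := by
    intro i j h
    by_contra hij
    have := congrFun h i
    simp [hij] at this
  have himg : Finset.Nat.antidiagonalTuple n 1
      = Finset.univ.image fun i : Fin n => (Pi.single i 1 : Fin n → ℕ) := by
    ext a
    rw [Finset.Nat.mem_antidiagonalTuple]
    simp only [Finset.mem_image, Finset.mem_univ, true_and]
    constructor
    · intro h
      -- A nonzero entry already uses up the total 1, so the others vanish.
      obtain ⟨i, -, hi⟩ := Finset.exists_ne_zero_of_sum_ne_zero (h ▸ one_ne_zero)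
      have hs := Finset.add_sum_erase Finset.univ a (Finset.mem_univ i)
      have h0 : ∑ j ∈ Finset.univ.erase i, a j = 0 := by omega
      refine ⟨i, _root_.funext fun j => ?_⟩
      rcases eq_or_ne j i with rfl | hj
      · rw [Pi.single_eq_same]; omega
      · rw [Pi.single_eq_of_ne hj]
        exact (Finset.sum_eq_zero_iff.1 h0 j (by simp [hj])).symm
    · rintro ⟨i, rfl⟩
      simp
  rw [himg, Finset.sum_image fun i _ j _ h => hinj h]

lemma ofFn_single_add_one {n : ℕ} (i : Fin n) :
    (List.ofFn fun j : Fin n => (Pi.single i 1 : Fin n → ℕ) j + 1)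
      = List.replicate i 1 ++ 2 :: List.replicate (n - 1 - i) 1 := by
  apply List.ext_getElem
  · simp; omega
  · intro m h1 h2
    rw [List.getElem_ofFn, List.getElem_append]
    have hm : m < n := by simpa using h1
    split_ifs with h
    · rw [Pi.single_eq_of_ne]
      · simp
      · intro e
        rw [List.length_replicate, ← e] at h
        exact lt_irrefl _ h
    · rw [List.length_replicate] at h
      rw [List.getElem_cons]
      split_ifs with h'
      · rw [List.length_replicate] at h'
        have : (⟨m, by simpa using h1⟩ : Fin n) = i := Fin.ext (by simp; omega)
        rw [this]; simp
      · rw [List.length_replicate] at h'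
        rw [Pi.single_eq_of_ne]
        · simp
        · intro e
          apply h'
          rw [← e]; simp

/-- The unit vector at the last place gives (3,{1}^(k+1)) with weight 2; one at place `i` puts a 2
among the ones, with weight 1. -/
lemma sum_antidiagonalTuple_imzv (k : ℕ) :
    ∑ a ∈ Finset.Nat.antidiagonalTuple (k + 2) 1,
        ((a (Fin.last (k + 1)) : ℝ[X]) + 1) *
          imzv ((a (Fin.last (k + 1)) + 2) ::
            List.ofFn fun i : Fin (k + 1) => a i.castSucc + 1)
      = 2 * imzv (3 :: List.replicate (k + 1) 1)
        + ∑ i ∈ Finset.range (k + 1),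
          imzv (2 :: (List.replicate i 1 ++ 2 :: List.replicate (k - i) 1)) := by
  rw [sum_antidiagonalTuple_one, Fin.sum_univ_castSucc, add_comm, Finset.sum_range]
  congr 1
  · have h : (List.ofFn fun i : Fin (k + 1) =>
        (Pi.single (Fin.last (k + 1)) 1 : Fin (k + 2) → ℕ) i.castSucc + 1)
        = List.replicate (k + 1) 1 := by
      rw [← List.ofFn_const]
      congr 1
      ext i
      rw [Pi.single_eq_of_ne (Fin.castSucc_lt_last i).ne]
    rw [h, Pi.single_eq_same]
    norm_num
  · refine Finset.sum_congr rfl fun i _ => ?_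
    have h : (fun j : Fin (k + 1) =>
        (Pi.single i.castSucc 1 : Fin (k + 2) → ℕ) j.castSucc + 1)
        = fun j => (Pi.single i 1 : Fin (k + 1) → ℕ) j + 1 := by
      ext j
      simp [Pi.single_apply]
    rw [h, ofFn_single_add_one, Pi.single_eq_of_ne (Fin.castSucc_lt_last i).ne']
    simp

lemma sum_alternating_mul_reflect_eq_zero {R : Type*} [CommRing R] [NoZeroDivisors R] [CharZero R]
    (f : ℕ → R) {k : ℕ} (hk : Odd k) :
    ∑ j ∈ Finset.range (k + 1), (-1) ^ j * f j * f (k - j) = 0 := by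
  refine self_eq_neg.1 ?_
  rw [← Finset.sum_neg_distrib]
  nth_rewrite 1 [← Finset.sum_range_reflect]
  refine Finset.sum_congr rfl fun j hj => ?_
  have hj' : j ≤ k := Nat.lt_succ_iff.1 (Finset.mem_range.1 hj)
  have hs : (-1 : R) ^ (k - j) = -(-1) ^ j := by
    have h1 : (-1 : R) ^ (k - j) * (-1) ^ j = -1 := by
      rw [← pow_add, Nat.sub_add_cancel hj', hk.neg_one_pow]
    have h2 : (-1 : R) ^ j * (-1) ^ j = 1 := by
      rw [← pow_add]; exact Even.neg_one_pow ⟨j, rfl⟩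
    calc (-1 : R) ^ (k - j) = (-1) ^ (k - j) * (-1) ^ j * (-1) ^ j := by
          rw [mul_assoc, h2, mul_one]
      _ = _ := by rw [h1]; ring
  rw [show k + 1 - 1 - j = k - j by omega, Nat.sub_sub_self hj', hs]
  ring

end IMZV

open IMZV
theorem proposition4p3 (k : ℕ) (hk : 1 ≤ k) :
    (Odd k →
      ∑ j ∈ Finset.range (k + 1),
        (-1 : ℝ[X]) ^ j * imzv (2 :: List.replicate j 1) * imzv (2 :: List.replicate (k - j) 1)
        = 0) ∧
    (Even k →
      ∑ j ∈ Finset.range (k + 1),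
        (-1 : ℝ[X]) ^ j * imzv (2 :: List.replicate j 1) * imzv (2 :: List.replicate (k - j) 1)
        = 2 * ((∑ a ∈ Finset.Nat.antidiagonalTuple (k + 2) 1,
                  ((a (Fin.last (k + 1)) : ℝ[X]) + 1) *
                    imzv ((a (Fin.last (k + 1)) + 2) ::
                      List.ofFn fun i : Fin (k + 1) => a i.castSucc + 1))
              + X * (∑ i ∈ Finset.range k,
                  (2 * (-1 : ℝ[X]) ^ i - 1) *
                    imzv (2 :: (List.replicate i 1 ++ 3 :: List.replicate (k - i - 1) 1)))
              - 3 * X * imzv (4 :: List.replicate k 1))) := by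
  refine ⟨fun h => sum_alternating_mul_reflect_eq_zero
    (fun j => imzv (2 :: List.replicate j 1)) h, fun h => ?_⟩
  rw [sum_antidiagonalTuple_imzv]
  -- Convergence was shown for `t ≥ 0` only, and infinitely many values determine a polynomial.
  refine eq_of_infinite_eval_eq _ _ ((Set.Ici_infinite (0 : ℝ)).mono fun t ht => ?_)
  have key := eval_sum_imzv_mul_imzv (Set.mem_Ici.1 ht) h
  simpa [eval_finsetSum] using key
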